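/- Let $\mathbf{CMet}$ be the category whose objects are complete metric spaces and whose morphisms are short maps ($d(f(x),f(x'))\le d(x,x')$), with the symmetric monoidal structure in which $X\otimes Y$ is the set $X\times Y$ with the metric $d((x,y),(x',y'))=d(x,x')+d(y,y')$, the unit is the one-point space, and the coherence isomorphisms are the evident ones. For a complete metric space $X$ let $PX$ be the set of Radon probability measures $p$ on the Borel sets of $X$ with finite first moment (every short map $X\to\mathbb{R}$ is $p$-integrable), with the metric $d(p,q)=\sup_f\left|\int f\,dp-\int f\,dq\right|$, the supremum being over all short maps $f:X\to\mathbb{R}$. With push-forward of measures along short maps, unit $\delta:X\to PX$ given by the Dirac measures, and multiplication $E:PPX\to PX$ given by $\int_X f\,d(E\mu)=\int_{PX}\int_X f\,dp\,d\mu(p)$ for all short $f:X\to\mathbb{R}$, $P$ is a monad on $\mathbf{CMet}$, the Kantorovich monad. For $p\in PX$, $q\in PY$ let $p\otimes_\nabla q\in P(X\otimes Y)$ be the product joint, determined by $\int f\,d(p\otimes_\nabla q)=\iint f(x,y)\,dq(y)\,dp(x)$ for all short $f:X\otimes Y\to\mathbb{R}$. Corollary. The Kantorovich monad $(P,\delta,E)$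 on the symmetric monoidal category $\mathbf{CMet}$ is a commutative strong monad, with strength $t_{X,Y}: X\otimes PY\to P(X\otimes Y)$ given by $t_{X,Y}(x,q)=\delta_x\otimes_\nabla q$. Explicitly: the maps $t_{X,Y}$ are short, are natural in $X$ and $Y$, are compatible with the left unitors and the associators, and satisfy $t_{X,Y}\circ(\mathrm{id}\otimes\delta)=\delta$ and $t_{X,Y}\circ(\mathrm{id}\otimes E)=E\circ P(t_{X,Y})\circ t_{X,PY}$; moreover, with $t'_{X,Y}:PX\otimes Y\to P(X\otimes Y)$ the costrength obtained from $t_{Y,X}$ by conjugating with the symmetry, the two maps $E\circ P(t'_{X,Y})\circ t_{PX,Y}$ and $E\circ P(t_{X,Y})\circ t'_{X,PY}$ from $PX\otimes PY$ to $P(X\otimes Y)$ are equal. -/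

import Mathlib

open MeasureTheory Filter Topology CategoryTheory MonoidalCategory
open scoped NNReal ENNReal

universe u

/-- The Kantorovich space of `X`: Radon probability measures on the Borel sets of `X`
with finite first moment, i.e. for which every short map `X → ℝ` is integrable. -/
@[ext]
structure KantorovichSpace (X : Type u) [MetricSpace X] [MeasurableSpace X] : Type u where
  toMeasure : Measure X
  isProbabilityMeasure : IsProbabilityMeasure toMeasure
  innerRegular : toMeasure.InnerRegular
  integrable : ∀ f : X → ℝ, LipschitzWith 1 f → Integrable f toMeasure

namespace KantorovichSpace

attribute [instance] isProbabilityMeasure innerRegular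

section Metric

variable {X : Type u} [MetricSpace X] [MeasurableSpace X]

theorem integrable_lip (p : KantorovichSpace X) {K : ℝ≥0} (hK : 0 < K) {f : X → ℝ}
    (hf : LipschitzWith K f) : Integrable f p.toMeasure := by
  have h : LipschitzWith 1 fun x => (K : ℝ)⁻¹ * f x := by
    refine LipschitzWith.of_dist_le_mul fun x y => ?_
    have := hf.dist_le_mul x y
    rw [Real.dist_eq] at this ⊢
    rw [← mul_sub, abs_mul, abs_of_pos (by positivity), inv_mul_le_iff₀ (by positivity)]
    simpa using this
  have h2 := (p.integrable _ h).const_mul (K : ℝ)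
  have hK' : (K : ℝ) ≠ 0 := by positivity
  simpa [mul_inv_cancel_left₀ hK'] using h2

theorem bddAbove_gap (p q : KantorovichSpace X) : BddAbove (Set.range fun f : {f : X → ℝ // LipschitzWith 1 f} =>
      |∫ x, f.1 x ∂p.toMeasure - ∫ x, f.1 x ∂q.toMeasure|) := by
  obtain ⟨x₀⟩ : Nonempty X := p.toMeasure.nonempty_of_neZero
  have hd : LipschitzWith 1 fun x : X => dist x x₀ := LipschitzWith.dist_left x₀
  refine ⟨∫ x, dist x x₀ ∂p.toMeasure + ∫ x, dist x x₀ ∂q.toMeasure, ?_⟩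
  rintro _ ⟨⟨f, hf⟩, rfl⟩
  have key (r : KantorovichSpace X) :
      |∫ x, f x ∂r.toMeasure - f x₀| ≤ ∫ x, dist x x₀ ∂r.toMeasure := by
    have : ∫ x, f x ∂r.toMeasure - f x₀ = ∫ x, (f x - f x₀) ∂r.toMeasure := by
      rw [integral_sub (r.integrable f hf) (integrable_const _)]; simp
    rw [this]
    refine (abs_integral_le_integral_abs).trans (integral_mono ?_ (r.integrable _ hd) ?_)
    · exact ((r.integrable f hf).sub (integrable_const _)).abs
    · intro x
      simpa [Real.dist_eq] using hf.dist_le_mul x x₀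
  have h1 := key p
  have h2 := key q
  simp only
  rw [abs_le] at *
  constructor <;> linarith

/-- The Kantorovich distance: the supremum of `|∫ f dp - ∫ f dq|` over all short maps
`f : X → ℝ`. -/
noncomputable instance : Dist (KantorovichSpace X) :=
  ⟨fun p q => ⨆ f : {f : X → ℝ // LipschitzWith 1 f},
    |∫ x, f.1 x ∂p.toMeasure - ∫ x, f.1 x ∂q.toMeasure|⟩

theorem gap_le_dist (p q : KantorovichSpace X) {f : X → ℝ} (hf : LipschitzWith 1 f) :
    |∫ x, f x ∂p.toMeasure - ∫ x, f x ∂q.toMeasure| ≤ dist p q :=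
  le_ciSup (bddAbove_gap p q) ⟨f, hf⟩

theorem dist_le_of_gap {p q : KantorovichSpace X} {r : ℝ}
    (h : ∀ f : X → ℝ, LipschitzWith 1 f →
      |∫ x, f x ∂p.toMeasure - ∫ x, f x ∂q.toMeasure| ≤ r) : dist p q ≤ r := by
  have : Nonempty {f : X → ℝ // LipschitzWith 1 f} :=
    ⟨⟨fun _ => 0, (LipschitzWith.const 0).weaken (by simp)⟩⟩
  exact ciSup_le fun f => h f.1 f.2

theorem gap_le_lip (p q : KantorovichSpace X) {K : ℝ≥0} (hK : 0 < K) {f : X → ℝ}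
    (hf : LipschitzWith K f) :
    |∫ x, f x ∂p.toMeasure - ∫ x, f x ∂q.toMeasure| ≤ K * dist p q := by
  have h : LipschitzWith 1 fun x => (K : ℝ)⁻¹ * f x := by
    refine LipschitzWith.of_dist_le_mul fun x y => ?_
    have := hf.dist_le_mul x y
    rw [Real.dist_eq] at this ⊢
    rw [← mul_sub, abs_mul, abs_of_pos (by positivity), inv_mul_le_iff₀ (by positivity)]
    simpa using this
  have h2 := gap_le_dist p q h
  rw [integral_const_mul, integral_const_mul, ← mul_sub, abs_mul, abs_of_pos (by positivity),
    inv_mul_le_iff₀ (by positivity)] at h2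
  exact h2

variable [BorelSpace X]

/-- A Radon probability measure of finite first moment is determined by the integrals of the
short maps. -/
theorem ext_of_integral {p q : KantorovichSpace X}
    (h : ∀ f : X → ℝ, LipschitzWith 1 f →
      ∫ x, f x ∂p.toMeasure = ∫ x, f x ∂q.toMeasure) : p = q := by
  have h0 : ∀ K : ℝ≥0, 0 < K → ∀ f : X → ℝ, LipschitzWith K f →
      ∫ x, f x ∂p.toMeasure = ∫ x, f x ∂q.toMeasure := by
    intro K hK f hf
    have hd : dist p q ≤ 0 := dist_le_of_gap fun f hf => by simp [h f hf]
    have := gap_le_lip p q hK hf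
    have h3 : (K : ℝ) * dist p q ≤ 0 := mul_nonpos_of_nonneg_of_nonpos K.2 hd
    exact sub_eq_zero.1 (abs_nonpos_iff.1 (this.trans h3))
  have hF : ∀ F : Set X, IsClosed F → p.toMeasure F = q.toMeasure F := by
    intro F hF
    have hpos : ∀ n : ℕ, (0 : ℝ) < 1 / ((n : ℝ) + 1) := fun n => by positivity
    have hp := tendsto_integral_thickenedIndicator_of_isClosed p.toMeasure hF hpos
      tendsto_one_div_add_atTop_nhds_zero_nat
    have hq := tendsto_integral_thickenedIndicator_of_isClosed q.toMeasure hF hpos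
      tendsto_one_div_add_atTop_nhds_zero_nat
    have heq : ∀ n : ℕ, ∫ x, (thickenedIndicator (hpos n) F x : ℝ) ∂p.toMeasure =
        ∫ x, (thickenedIndicator (hpos n) F x : ℝ) ∂q.toMeasure := fun n =>
      h0 _ (inv_pos.2 (Real.toNNReal_pos.2 (hpos n))) _ (lipschitzWith_thickenedIndicator (hpos n) F)
    simp_rw [heq] at hp
    have := tendsto_nhds_unique hp hq
    simpa [Measure.real, ENNReal.toReal_eq_toReal_iff'] using this
  have : p.toMeasure = q.toMeasure := by
    refine ext_of_generate_finite {s | IsClosed s} ?_ isPiSystem_isClosed hF (by simp)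
    rw [BorelSpace.measurable_eq (α := X), borel_eq_generateFrom_isClosed]
  exact KantorovichSpace.ext this

noncomputable instance : MetricSpace (KantorovichSpace X) where
  dist_self p := le_antisymm (dist_le_of_gap fun f hf => by simp)
    ((abs_nonneg _).trans
      (gap_le_dist p p (f := fun _ => 0) ((LipschitzWith.const 0).weaken (by simp))))
  dist_comm p q := by
    refine le_antisymm (dist_le_of_gap fun f hf => ?_) (dist_le_of_gap fun f hf => ?_)
    all_goals rw [abs_sub_comm]; exact gap_le_dist _ _ hf
  dist_triangle p q r := dist_le_of_gap fun f hf =>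
    (abs_sub_le _ (∫ x, f x ∂q.toMeasure) _).trans
      (add_le_add (gap_le_dist p q hf) (gap_le_dist q r hf))
  eq_of_dist_eq_zero {p q} h := ext_of_integral fun f hf =>
    sub_eq_zero.1 (abs_nonpos_iff.1 ((gap_le_dist p q hf).trans h.le))

theorem lipschitzWith_integral {K : ℝ≥0} (hK : 0 < K) {f : X → ℝ} (hf : LipschitzWith K f) :
    LipschitzWith K fun p : KantorovichSpace X => ∫ x, f x ∂p.toMeasure :=
  LipschitzWith.of_dist_le_mul fun p q => by
    rw [Real.dist_eq]; exact gap_le_lip p q hK hf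

end Metric

/-- `KantorovichSpace X` carries its Borel sets. -/
noncomputable instance {X : Type u} [MetricSpace X] [MeasurableSpace X] [BorelSpace X] :
    MeasurableSpace (KantorovichSpace X) := borel _

instance {X : Type u} [MetricSpace X] [MeasurableSpace X] [BorelSpace X] :
    BorelSpace (KantorovichSpace X) := ⟨rfl⟩

section Tight

variable {X : Type u} [MetricSpace X] [MeasurableSpace X] [BorelSpace X]

theorem innerRegular_of_tight {m : Measure X}
    (h : ∀ ε : ℝ≥0∞, 0 < ε → ∃ K, IsCompact K ∧ m Kᶜ ≤ ε) [IsFiniteMeasure m] :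
    m.InnerRegular := by
  have h1 : m.InnerRegularWRT IsCompact IsClosed := by
    refine innerRegularWRT_of_exists_compl_lt (fun A B hA hB => hA.inter_right hB) ?_
    intro ε hε
    obtain ⟨δ, hδ, hδε⟩ := exists_between hε
    obtain ⟨K, hK, hm⟩ := h δ hδ
    exact ⟨K, hK, hm.trans_lt hδε⟩
  have h2 : m.InnerRegularWRT IsClosed (fun s => MeasurableSet s ∧ m s ≠ ∞) :=
    Measure.WeaklyRegular.innerRegular_measurable
  have h3 : m.InnerRegularCompactLTTop := ⟨h1.trans h2⟩
  infer_instance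

theorem exists_compact (p : KantorovichSpace X) {ε : ℝ≥0∞} (hε : 0 < ε) :
    ∃ K, IsCompact K ∧ p.toMeasure Kᶜ ≤ ε := by
  obtain ⟨K, hK, h⟩ := isTightMeasureSet_iff_exists_isCompact_measure_compl_le.1
    (isTightMeasureSet_singleton_of_innerRegular (μ := p.toMeasure)) ε hε
  exact ⟨K, hK, h _ rfl⟩

theorem measure_compl_cthickening_le {p q : KantorovichSpace X} {K : Set X} {δ : ℝ}
    (hδ : 0 < δ) (hK : MeasurableSet K) {η : ℝ} (hp : p.toMeasure.real Kᶜ ≤ η)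
    (hpq : dist q p ≤ δ * η) : q.toMeasure.real (Metric.cthickening δ K)ᶜ ≤ 2 * η := by
  have hlip := lipschitzWith_thickenedIndicator hδ K
  have hK0 : 0 < δ.toNNReal⁻¹ := inv_pos.2 (Real.toNNReal_pos.2 hδ)
  have hlip' : LipschitzWith δ.toNNReal⁻¹ fun x => (thickenedIndicator hδ K x : ℝ) := hlip
  have h1 := gap_le_lip q p hK0 hlip'
  have h2 : ((δ.toNNReal⁻¹ : ℝ≥0) : ℝ) * dist q p ≤ η := by
    rw [NNReal.coe_inv, Real.coe_toNNReal _ hδ.le, inv_mul_le_iff₀ hδ]; exact hpq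
  have h3 : p.toMeasure.real K ≤ ∫ x, (thickenedIndicator hδ K x : ℝ) ∂p.toMeasure := by
    rw [← integral_indicator_one hK]
    refine integral_mono ((integrable_const (1 : ℝ)).indicator hK)
      (integrable_thickenedIndicator K hδ) fun x => ?_
    by_cases hx : x ∈ K
    · simp [hx, thickenedIndicator_one hδ K hx]
    · simp [hx]
  have hC : MeasurableSet (Metric.cthickening δ K) := Metric.isClosed_cthickening.measurableSet
  have h4 : ∫ x, (thickenedIndicator hδ K x : ℝ) ∂q.toMeasure ≤
      q.toMeasure.real (Metric.cthickening δ K) := by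
    rw [← integral_indicator_one hC]
    refine integral_mono (integrable_thickenedIndicator K hδ)
      ((integrable_const (1 : ℝ)).indicator hC) fun x => ?_
    by_cases hx : x ∈ Metric.cthickening δ K
    · simpa [hx] using thickenedIndicator_le_one hδ K x
    · have : x ∉ Metric.thickening δ K := fun h => hx (Metric.thickening_subset_cthickening δ K h)
      simp [hx, thickenedIndicator_zero hδ K this]
  rw [probReal_compl_eq_one_sub hK] at hp
  rw [probReal_compl_eq_one_sub hC]
  have := (abs_le.1 h1).1
  linarith

/-- A totally bounded set of the Kantorovich space over a complete space is uniformly tight. -/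
theorem tight_of_totallyBounded [CompleteSpace X] {S : Set (KantorovichSpace X)}
    (hS : TotallyBounded S) {ε : ℝ≥0∞} (hε : 0 < ε) :
    ∃ K, IsCompact K ∧ ∀ q ∈ S, q.toMeasure Kᶜ ≤ ε := by
  obtain ⟨η, hη, hsum⟩ := ENNReal.exists_pos_sum_of_countable' hε.ne' ℕ
  have step : ∀ k : ℕ, ∃ K : Set X, IsCompact K ∧
      ∀ q ∈ S, q.toMeasure (Metric.cthickening (1 / ((k : ℝ) + 1)) K)ᶜ ≤ η k := by
    intro k
    have hδ : (0 : ℝ) < 1 / ((k : ℝ) + 1) := by positivity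
    obtain ⟨θ, hθ, hθη⟩ : ∃ θ : ℝ, 0 < θ ∧ ENNReal.ofReal (2 * θ) ≤ η k := by
      have : 0 < min (η k) 1 := lt_min (hη k) one_pos
      have hfin : min (η k) 1 ≠ ∞ := ne_top_of_le_ne_top ENNReal.one_ne_top (min_le_right _ _)
      refine ⟨(min (η k) 1).toReal / 2, by have := ENNReal.toReal_pos this.ne' hfin; positivity, ?_⟩
      rw [mul_div_cancel₀ _ two_ne_zero, ENNReal.ofReal_toReal hfin]
      exact min_le_left _ _
    obtain ⟨t, ht, hcov⟩ := Metric.totallyBounded_iff.1 hS (1 / ((k : ℝ) + 1) * θ) (by positivity)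
    choose C hC hCm using fun p : KantorovichSpace X =>
      exists_compact p (ε := ENNReal.ofReal θ) (by simpa using hθ)
    refine ⟨⋃ p ∈ t, C p, ht.isCompact_biUnion fun p _ => hC p, fun q hq => ?_⟩
    obtain ⟨p, hpt, hqp⟩ := Set.mem_iUnion₂.1 (hcov hq)
    have hKm : MeasurableSet (⋃ p ∈ t, C p) :=
      (ht.isCompact_biUnion fun p _ => hC p).measurableSet
    have h1 : p.toMeasure.real (⋃ p ∈ t, C p)ᶜ ≤ θ := by
      refine ENNReal.toReal_le_of_le_ofReal hθ.le ((measure_mono ?_).trans (hCm p))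
      exact Set.compl_subset_compl.2 (Set.subset_biUnion_of_mem (u := C) hpt)
    have h2 := measure_compl_cthickening_le hδ hKm h1 (Metric.mem_ball.1 hqp).le
    refine le_trans ?_ hθη
    rw [← ENNReal.ofReal_toReal (measure_ne_top q.toMeasure _)]
    exact ENNReal.ofReal_le_ofReal h2
  choose K hK hKS using step
  refine ⟨⋂ k : ℕ, Metric.cthickening (1 / ((k : ℝ) + 1)) (K k), ?_, fun q hq => ?_⟩
  · refine TotallyBounded.isCompact_of_isClosed ?_
      (isClosed_iInter fun k => Metric.isClosed_cthickening)
    rw [Metric.totallyBounded_iff]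
    intro r hr
    obtain ⟨k, hk⟩ := exists_nat_one_div_lt (show 0 < r / 2 by positivity)
    obtain ⟨t, ht, hcov⟩ := Metric.totallyBounded_iff.1 (hK k).totallyBounded (r / 2) (by positivity)
    refine ⟨t, ht, fun x hx => ?_⟩
    have hx' := Set.mem_iInter.1 hx k
    have hx2 : x ∈ Metric.thickening (r / 2) (K k) :=
      Metric.cthickening_subset_thickening' (by positivity) hk _ hx'
    obtain ⟨y, hy, hxy⟩ := Metric.mem_thickening_iff.1 hx2
    obtain ⟨z, hz, hyz⟩ := Set.mem_iUnion₂.1 (hcov hy)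
    refine Set.mem_iUnion₂.2 ⟨z, hz, ?_⟩
    have := dist_triangle x y z
    rw [Metric.mem_ball] at *
    linarith
  · rw [Set.compl_iInter]
    exact (measure_iUnion_le _).trans ((ENNReal.tsum_le_tsum fun k => hKS k q hq).trans hsum.le)

end Tight

section Complete

variable {X : Type u}

/-- Truncation of a real function to the interval `[-M, M]`. -/
def clamp (M : ℕ) (f : X → ℝ) (x : X) : ℝ := max (-(M : ℝ)) (min (f x) M)

theorem abs_clamp_le (f : X → ℝ) (M : ℕ) (x : X) : |clamp M f x| ≤ |f x| := by
  have hM : (0 : ℝ) ≤ M := M.cast_nonneg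
  unfold clamp
  rcases max_cases (-(M : ℝ)) (min (f x) M) with h | h <;>
  rcases min_cases (f x) (M : ℝ) with h' | h' <;>
  rcases abs_cases (f x) with h'' | h'' <;> rw [abs_le] <;> constructor <;> linarith

theorem abs_clamp_le_nat (f : X → ℝ) (M : ℕ) (x : X) : |clamp M f x| ≤ M := by
  have hM : (0 : ℝ) ≤ M := M.cast_nonneg
  rw [abs_le]
  exact ⟨le_max_left _ _, max_le (by linarith) (min_le_right _ _)⟩

theorem clamp_tendsto (f : X → ℝ) (x : X) : Tendsto (fun M => clamp M f x) atTop (𝓝 (f x)) := by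
  refine tendsto_const_nhds.congr' ?_
  obtain ⟨N, hN⟩ := exists_nat_ge |f x|
  filter_upwards [eventually_ge_atTop N] with M hM
  have : |f x| ≤ M := hN.trans (by exact_mod_cast hM)
  rw [abs_le] at this
  rw [clamp, min_eq_left this.2, max_eq_right this.1]

theorem clamp_lip [MetricSpace X] {f : X → ℝ} (hf : LipschitzWith 1 f) (M : ℕ) : LipschitzWith 1 (clamp M f) :=
  (hf.min_const _).const_max _

variable [MetricSpace X] [MeasurableSpace X] [BorelSpace X]

theorem integral_clamp_tendsto {m : Measure X} {f : X → ℝ} (hf : LipschitzWith 1 f)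
    (hi : Integrable f m) :
    Tendsto (fun M => ∫ x, clamp M f x ∂m) atTop (𝓝 (∫ x, f x ∂m)) :=
  tendsto_integral_of_dominated_convergence (fun x => |f x|)
    (fun M => (clamp_lip hf M).continuous.measurable.aestronglyMeasurable) hi.abs
    (fun M => ae_of_all _ fun x => abs_clamp_le f M x) (ae_of_all _ fun x => clamp_tendsto f x)

/-- The Kantorovich space over a complete metric space is complete. -/
instance [CompleteSpace X] : CompleteSpace (KantorovichSpace X) := by
  refine Metric.complete_of_cauchySeq_tendsto fun u hu => ?_
  -- uniform tightness and a weak cluster point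
  have hT := hu.totallyBounded_range
  obtain ⟨v, -, hv, hv0⟩ : ∃ v : ℕ → ℝ≥0, StrictAnti v ∧ (∀ n, 0 < v n) ∧ Tendsto v atTop (𝓝 0) :=
    exists_seq_strictAnti_tendsto 0
  choose K hK hKu using fun n =>
    tight_of_totallyBounded hT (ε := (v n : ℝ≥0∞)) (by exact_mod_cast hv n)
  let U : ℕ → ProbabilityMeasure X := fun n => ⟨(u n).toMeasure, inferInstance⟩
  have hcomp := isCompact_setOfPred_probabilityMeasure_mass_eq_compl_isCompact_le (E := X) hv0 hK
    (Or.inl inferInstance)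
  have hU : ∀ n, U n ∈ {μ : ProbabilityMeasure X | ∀ n, μ (K n)ᶜ ≤ v n} := by
    intro n k
    have : (u n).toMeasure (K k)ᶜ ≤ v k := hKu k _ ⟨n, rfl⟩
    rw [← ENNReal.coe_le_coe, ProbabilityMeasure.ennreal_coeFn_eq_coeFn_toMeasure]
    exact this
  let F : Ultrafilter ℕ := hyperfilter ℕ
  have hF : (F : Filter ℕ) ≤ atTop := Nat.hyperfilter_le_atTop
  obtain ⟨μ, hμ, hlim⟩ := hcomp.ultrafilter_le_nhds' (F.map U)
    (Ultrafilter.mem_map.2 (Filter.univ_mem' hU))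
  have hlim' : Tendsto U F (𝓝 μ) := hlim
  have hconv := ProbabilityMeasure.tendsto_iff_forall_integral_tendsto.1 hlim'
  have hconv' : ∀ f : X → ℝ, LipschitzWith 1 f → ∀ M : ℕ,
      Tendsto (fun n => ∫ x, clamp M f x ∂(u n).toMeasure) F
        (𝓝 (∫ x, clamp M f x ∂(μ : Measure X))) := by
    intro f hf M
    exact hconv (BoundedContinuousFunction.ofNormedAddCommGroup (clamp M f)
      (clamp_lip hf M).continuous M (abs_clamp_le_nat f M))
  have hreg : (μ : Measure X).InnerRegular := by
    refine innerRegular_of_tight fun ε hε => ?_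
    obtain ⟨n, hn⟩ : ∃ n, (v n : ℝ≥0∞) < ε := by
      have h0 : Tendsto (fun n => (v n : ℝ≥0∞)) atTop (𝓝 0) := ENNReal.tendsto_coe.2 hv0
      exact (h0.eventually_lt_const hε).exists
    refine ⟨K n, hK n, le_trans ?_ hn.le⟩
    have := hμ n
    rw [← ENNReal.coe_le_coe, ProbabilityMeasure.ennreal_coeFn_eq_coeFn_toMeasure] at this
    exact this
  -- finite first moment of the limit
  have hint : ∀ f : X → ℝ, LipschitzWith 1 f → Integrable f (μ : Measure X) := by
    intro f hf
    have habs : LipschitzWith 1 fun x => |f x| := by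
      have := (lipschitzWith_one_norm (E := ℝ)).comp hf
      rwa [mul_one] at this
    obtain ⟨C, hC⟩ : ∃ C : ℝ, ∀ n, ∫ x, |f x| ∂(u n).toMeasure ≤ C := by
      have hc := (lipschitzWith_integral one_pos habs).uniformContinuous.comp_cauchySeq hu
      obtain ⟨C, hC⟩ := hc.isBounded_range.bddAbove
      exact ⟨C, fun n => hC ⟨n, rfl⟩⟩
    have hCM : ∀ M : ℕ, ∫ x, clamp M (fun x => |f x|) x ∂(μ : Measure X) ≤ C := by
      intro M
      refine le_of_tendsto (hconv' _ habs M) (Eventually.of_forall fun n => ?_)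
      refine le_trans (integral_mono ((u n).integrable _ (clamp_lip habs M))
        ((u n).integrable _ habs) fun x => ?_) (hC n)
      have := abs_clamp_le (fun x => |f x|) M x
      exact (le_abs_self _).trans (this.trans (abs_abs (f x)).le)
    refine ⟨hf.continuous.measurable.aestronglyMeasurable, ?_⟩
    have hnn : ∀ M x, 0 ≤ clamp M (fun x => |f x|) x := fun M x =>
      le_max_of_le_right (le_min (abs_nonneg _) M.cast_nonneg)
    have hl : ∀ M : ℕ, ∫⁻ x, ENNReal.ofReal (clamp M (fun x => |f x|) x) ∂(μ : Measure X) ≤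
        ENNReal.ofReal C := by
      intro M
      rw [← ofReal_integral_eq_lintegral_ofReal]
      · exact ENNReal.ofReal_le_ofReal (hCM M)
      · refine Integrable.of_bound
          (clamp_lip habs M).continuous.measurable.aestronglyMeasurable M (ae_of_all _ fun x => ?_)
        exact abs_clamp_le_nat _ M x
      · exact ae_of_all _ fun x => hnn M x
    have hfat : ∫⁻ x, ENNReal.ofReal |f x| ∂(μ : Measure X) ≤ ENNReal.ofReal C := by
      have hmeas : ∀ M : ℕ, Measurable fun x => ENNReal.ofReal (clamp M (fun x => |f x|) x) :=
        fun M => (clamp_lip habs M).continuous.measurable.ennreal_ofReal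
      have h1 := lintegral_liminf_le (μ := (μ : Measure X)) (u := atTop) hmeas
      have h2 : ∀ x, liminf (fun M : ℕ => ENNReal.ofReal (clamp M (fun x => |f x|) x)) atTop =
          ENNReal.ofReal |f x| := fun x =>
        (ENNReal.tendsto_ofReal (clamp_tendsto (fun x => |f x|) x)).liminf_eq
      simp_rw [h2] at h1
      refine h1.trans ?_
      calc _ ≤ liminf (fun _ : ℕ => ENNReal.ofReal C) atTop :=
            liminf_le_liminf (Eventually.of_forall hl)
        _ = _ := by simp
    rw [hasFiniteIntegral_iff_norm]
    exact hfat.trans_lt ENNReal.ofReal_lt_top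
  let p : KantorovichSpace X := ⟨μ, inferInstance, hreg, hint⟩
  refine ⟨p, Metric.tendsto_atTop.2 fun ε hε => ?_⟩
  obtain ⟨N, hN⟩ := Metric.cauchySeq_iff.1 hu (ε / 2) (by positivity)
  refine ⟨N, fun n hn => lt_of_le_of_lt (dist_le_of_gap fun f hf => ?_) (half_lt_self hε)⟩
  have hM : ∀ M : ℕ, |∫ x, clamp M f x ∂(u n).toMeasure - ∫ x, clamp M f x ∂(μ : Measure X)| ≤
      ε / 2 := by
    intro M
    refine le_of_tendsto (tendsto_const_nhds.sub (hconv' f hf M)).abs ?_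
    filter_upwards [hF (eventually_ge_atTop N)] with m hm
    exact (gap_le_dist (u n) (u m) (clamp_lip hf M)).trans (hN n hn m hm).le
  exact le_of_tendsto ((integral_clamp_tendsto hf ((u n).integrable f hf)).sub
    (integral_clamp_tendsto hf (hint f hf))).abs (Eventually.of_forall hM)

end Complete

section Operations

theorem lip_comp {X Y Z : Type*} [MetricSpace X] [MetricSpace Y] [MetricSpace Z] {f : X → Y}
    (hf : LipschitzWith 1 f) {g : Y → Z} (hg : LipschitzWith 1 g) :
    LipschitzWith 1 fun x => g (f x) := by
  have := hg.comp hf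
  rwa [mul_one] at this

variable {X Y Z : Type u} [MetricSpace X] [MeasurableSpace X] [BorelSpace X]
  [MetricSpace Y] [MeasurableSpace Y] [BorelSpace Y]
  [MetricSpace Z] [MeasurableSpace Z] [BorelSpace Z]

/-- The Dirac distribution at `x`. -/
noncomputable def dirac (x : X) : KantorovichSpace X where
  toMeasure := Measure.dirac x
  isProbabilityMeasure := inferInstance
  innerRegular := innerRegular_of_tight fun ε _ => ⟨{x}, isCompact_singleton, by
    rw [Measure.dirac_apply' _ (measurableSet_singleton x).compl]; simp⟩
  integrable f hf := integrable_dirac' hf.continuous.measurable.stronglyMeasurable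
    enorm_lt_top

theorem integral_dirac (x : X) {f : X → ℝ} (hf : LipschitzWith 1 f) :
    ∫ y, f y ∂(dirac x).toMeasure = f x :=
  integral_dirac' f x hf.continuous.measurable.stronglyMeasurable

theorem lipschitzWith_dirac : LipschitzWith 1 (dirac : X → KantorovichSpace X) :=
  LipschitzWith.of_dist_le_mul fun x y => dist_le_of_gap fun f hf => by
    rw [integral_dirac x hf, integral_dirac y hf]
    exact hf.dist_le_mul x y

/-- The push-forward of `p` along the short map `f`. -/
noncomputable def map (f : X → Y) (hf : LipschitzWith 1 f) (p : KantorovichSpace X) :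
    KantorovichSpace Y where
  toMeasure := p.toMeasure.map f
  isProbabilityMeasure := Measure.isProbabilityMeasure_map hf.continuous.measurable.aemeasurable
  innerRegular := Measure.InnerRegular.map_of_continuous hf.continuous
  integrable g hg := by
    rw [integrable_map_measure hg.continuous.measurable.aestronglyMeasurable
      hf.continuous.measurable.aemeasurable]
    exact p.integrable _ (by simpa using hg.comp hf)

theorem integral_map {f : X → Y} (hf : LipschitzWith 1 f) (p : KantorovichSpace X) {g : Y → ℝ}
    (hg : LipschitzWith 1 g) :
    ∫ y, g y ∂(map f hf p).toMeasure = ∫ x, g (f x) ∂p.toMeasure :=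
  MeasureTheory.integral_map hf.continuous.measurable.aemeasurable
    hg.continuous.measurable.aestronglyMeasurable

theorem lipschitzWith_map {f : X → Y} (hf : LipschitzWith 1 f) : LipschitzWith 1 (map f hf) :=
  LipschitzWith.of_dist_le_mul fun p q => dist_le_of_gap fun g hg => by
    rw [integral_map hf p hg, integral_map hf q hg]
    simpa using gap_le_dist p q (by simpa using hg.comp hf : LipschitzWith 1 (g ∘ f))

theorem map_id (p : KantorovichSpace X) : map id LipschitzWith.id p = p :=
  ext_of_integral fun _ hg => integral_map _ p hg

theorem map_map {f : X → Y} (hf : LipschitzWith 1 f) {g : Y → Z} (hg : LipschitzWith 1 g)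
    (hgf : LipschitzWith 1 (g ∘ f)) (p : KantorovichSpace X) :
    map g hg (map f hf p) = map (g ∘ f) hgf p :=
  ext_of_integral fun h hh => by
    rw [integral_map hg _ hh, integral_map hf p (lip_comp hg hh), integral_map hgf p hh]
    rfl

theorem map_dirac {f : X → Y} (hf : LipschitzWith 1 f) (x : X) :
    map f hf (dirac x) = dirac (f x) :=
  ext_of_integral fun h hh => by
    rw [integral_map hf _ hh, integral_dirac x (lip_comp hf hh), integral_dirac _ hh]

theorem measurable_toMeasure :
    Measurable (toMeasure : KantorovichSpace X → Measure X) := by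
  refine Measurable.measure_of_isPiSystem_of_isProbabilityMeasure (S := {s | IsClosed s})
    (by rw [BorelSpace.measurable_eq (α := X), borel_eq_generateFrom_isClosed])
    isPiSystem_isClosed fun F hF => ?_
  have hpos : ∀ n : ℕ, (0 : ℝ) < 1 / ((n : ℝ) + 1) := fun n => by positivity
  have h : Measurable fun p : KantorovichSpace X => p.toMeasure.real F := by
    refine measurable_of_tendsto_metrizable
      (f := fun (n : ℕ) (p : KantorovichSpace X) =>
        ∫ x, (thickenedIndicator (hpos n) F x : ℝ) ∂p.toMeasure) (fun n => ?_)
      (tendsto_pi_nhds.2 fun p => tendsto_integral_thickenedIndicator_of_isClosed p.toMeasure hF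
        hpos tendsto_one_div_add_atTop_nhds_zero_nat)
    exact (lipschitzWith_integral (inv_pos.2 (Real.toNNReal_pos.2 (hpos n)))
      (lipschitzWith_thickenedIndicator (hpos n) F)).continuous.measurable
  have h2 : (fun p : KantorovichSpace X => p.toMeasure F) =
      fun p => ENNReal.ofReal (p.toMeasure.real F) := by
    funext p; simp [Measure.real]
  rw [h2]
  exact h.ennreal_ofReal

/-- The evaluation of measures as a Markov kernel. -/
noncomputable def evalKernel (X : Type u) [MetricSpace X] [MeasurableSpace X] [BorelSpace X] :
    ProbabilityTheory.Kernel (KantorovichSpace X) X := ⟨toMeasure, measurable_toMeasure⟩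

instance : ProbabilityTheory.IsMarkovKernel (evalKernel X) :=
  ⟨fun p => p.isProbabilityMeasure⟩

variable [CompleteSpace X]

/-- The expected (average) distribution `E μ` of `μ ∈ PPX`: the mixture
`(E μ)(A) = ∫ p(A) dμ(p)`. -/
noncomputable def expect (μ : KantorovichSpace (KantorovichSpace X)) : KantorovichSpace X where
  toMeasure := μ.toMeasure.bind toMeasure
  isProbabilityMeasure :=
    inferInstanceAs (IsProbabilityMeasure (μ.toMeasure.bind (evalKernel X)))
  innerRegular := by
    have : IsProbabilityMeasure (μ.toMeasure.bind (toMeasure : KantorovichSpace X → Measure X)) :=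
      inferInstanceAs (IsProbabilityMeasure (μ.toMeasure.bind (evalKernel X)))
    refine innerRegular_of_tight fun ε hε => ?_
    have hε2 : 0 < ε / 2 := ENNReal.half_pos hε.ne'
    obtain ⟨C, hC, hμC⟩ := exists_compact μ hε2
    obtain ⟨K, hK, hKC⟩ := tight_of_totallyBounded hC.totallyBounded hε2
    refine ⟨K, hK, ?_⟩
    rw [Measure.bind_apply hK.measurableSet.compl measurable_toMeasure.aemeasurable,
      ← lintegral_add_compl _ hC.measurableSet, ← ENNReal.add_halves ε]
    refine add_le_add ?_ ?_
    · calc ∫⁻ p in C, p.toMeasure Kᶜ ∂μ.toMeasure ≤ ∫⁻ p in C, ε / 2 ∂μ.toMeasure :=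
            setLIntegral_mono measurable_const hKC
        _ ≤ ε / 2 := by
            rw [setLIntegral_const]
            exact mul_le_of_le_one_right (zero_le) prob_le_one
    · calc ∫⁻ p in Cᶜ, p.toMeasure Kᶜ ∂μ.toMeasure ≤ ∫⁻ p in Cᶜ, 1 ∂μ.toMeasure :=
            lintegral_mono fun p => prob_le_one
        _ ≤ ε / 2 := by rw [setLIntegral_const, one_mul]; exact hμC
  integrable f hf := by
    refine (Measure.integrable_comp_iff (κ := evalKernel X) (μ := μ.toMeasure)
      hf.continuous.measurable.aestronglyMeasurable).2
      ⟨ae_of_all _ fun p => p.integrable f hf, ?_⟩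
    have habs : LipschitzWith 1 fun x => ‖f x‖ := by
      have := (lipschitzWith_one_norm (E := ℝ)).comp hf
      rwa [mul_one] at this
    exact μ.integrable _ (lipschitzWith_integral one_pos habs)

theorem integral_expect (μ : KantorovichSpace (KantorovichSpace X)) {f : X → ℝ}
    (hf : LipschitzWith 1 f) :
    ∫ x, f x ∂(expect μ).toMeasure = ∫ p, (∫ x, f x ∂p.toMeasure) ∂μ.toMeasure := by
  have h : (expect μ).toMeasure =
      (ProbabilityTheory.Kernel.comp (evalKernel X)
        (ProbabilityTheory.Kernel.const Unit μ.toMeasure)) () :=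
    Measure.comp_eq_comp_const_apply (κ := evalKernel X)
  have hi := (expect μ).integrable f hf
  rw [h] at hi ⊢
  simpa [evalKernel] using ProbabilityTheory.Kernel.integral_comp hi

theorem lipschitzWith_expect :
    LipschitzWith 1 (expect : KantorovichSpace (KantorovichSpace X) → KantorovichSpace X) :=
  LipschitzWith.of_dist_le_mul fun μ ν => dist_le_of_gap fun f hf => by
    rw [integral_expect μ hf, integral_expect ν hf]
    simpa using gap_le_dist μ ν (lipschitzWith_integral one_pos hf)

theorem map_expect [CompleteSpace Y] {f : X → Y} (hf : LipschitzWith 1 f)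
    (m : KantorovichSpace (KantorovichSpace X)) :
    map f hf (expect m) = expect (map (map f hf) (lipschitzWith_map hf) m) :=
  ext_of_integral fun h hh => by
    rw [integral_map hf _ hh, integral_expect m (lip_comp hf hh), integral_expect _ hh,
      integral_map _ _ (lipschitzWith_integral one_pos hh)]
    exact integral_congr_ae (ae_of_all _ fun p => (integral_map hf p hh).symm)

theorem expect_map_expect (m : KantorovichSpace (KantorovichSpace (KantorovichSpace X))) :
    expect (map expect lipschitzWith_expect m) = expect (expect m) :=
  ext_of_integral fun g hg => by
    rw [integral_expect _ hg, integral_map _ _ (lipschitzWith_integral one_pos hg),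
      integral_expect _ hg, integral_expect _ (lipschitzWith_integral one_pos hg)]
    exact integral_congr_ae (ae_of_all _ fun p => integral_expect p hg)

theorem expect_dirac (p : KantorovichSpace X) : expect (dirac p) = p :=
  ext_of_integral fun g hg => by
    rw [integral_expect _ hg, integral_dirac _ (lipschitzWith_integral one_pos hg)]

theorem expect_map_dirac (p : KantorovichSpace X) :
    expect (map dirac lipschitzWith_dirac p) = p :=
  ext_of_integral fun g hg => by
    rw [integral_expect _ hg, integral_map _ _ (lipschitzWith_integral one_pos hg)]
    exact integral_congr_ae (ae_of_all _ fun x => integral_dirac x hg)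

end Operations

end KantorovichSpace

/-- The set `X × Y` with the metric `d((x,y),(x',y')) = d(x,x') + d(y,y')`. -/
@[ext]
structure TensorSpace (X Y : Type u) : Type u where
  fst : X
  snd : Y

namespace TensorSpace

variable {X Y : Type u} [MetricSpace X] [MetricSpace Y]

instance : MetricSpace (TensorSpace X Y) where
  dist a b := dist a.fst b.fst + dist a.snd b.snd
  dist_self a := by simp
  dist_comm a b := by simp [dist_comm]
  dist_triangle a b c := by
    have h1 := dist_triangle a.fst b.fst c.fst
    have h2 := dist_triangle a.snd b.snd c.snd
    linarith
  eq_of_dist_eq_zero {a b} h := by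
    have h1 := dist_nonneg (x := a.fst) (y := b.fst)
    have h2 := dist_nonneg (x := a.snd) (y := b.snd)
    exact TensorSpace.ext (dist_le_zero.1 (by linarith)) (dist_le_zero.1 (by linarith))

theorem dist_def (a b : TensorSpace X Y) : dist a b = dist a.fst b.fst + dist a.snd b.snd := rfl

instance [CompleteSpace X] [CompleteSpace Y] : CompleteSpace (TensorSpace X Y) := by
  refine Metric.complete_of_cauchySeq_tendsto fun u hu => ?_
  have h1 : LipschitzWith 1 (fst : TensorSpace X Y → X) := LipschitzWith.of_dist_le_mul fun a b => by
    simp [dist_def]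
  have h2 : LipschitzWith 1 (snd : TensorSpace X Y → Y) := LipschitzWith.of_dist_le_mul fun a b => by
    simp [dist_def]
  obtain ⟨x, hx⟩ := cauchySeq_tendsto_of_complete (h1.uniformContinuous.comp_cauchySeq hu)
  obtain ⟨y, hy⟩ := cauchySeq_tendsto_of_complete (h2.uniformContinuous.comp_cauchySeq hu)
  refine ⟨⟨x, y⟩, tendsto_iff_dist_tendsto_zero.2 ?_⟩
  simpa [dist_def] using (tendsto_iff_dist_tendsto_zero.1 hx).add (tendsto_iff_dist_tendsto_zero.1 hy)

/-- `TensorSpace X Y` carries the Borel sets of its metric. -/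
instance : MeasurableSpace (TensorSpace X Y) := borel _

instance : BorelSpace (TensorSpace X Y) := ⟨rfl⟩

theorem lipschitzWith_mk_right (x : X) : LipschitzWith 1 fun y : Y => (⟨x, y⟩ : TensorSpace X Y) :=
  LipschitzWith.of_dist_le_mul fun a b => by simp [dist_def]

theorem lipschitzWith_mk_left (y : Y) : LipschitzWith 1 fun x : X => (⟨x, y⟩ : TensorSpace X Y) :=
  LipschitzWith.of_dist_le_mul fun a b => by simp [dist_def]

end TensorSpace

namespace KantorovichSpace

variable {X Y : Type u} [MetricSpace X] [MetricSpace Y] [MeasurableSpace Y] [BorelSpace Y]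

theorem lipschitzWith_section (q : KantorovichSpace Y) :
    LipschitzWith 1 fun x : X => map (fun y : Y => (⟨x, y⟩ : TensorSpace X Y))
      (TensorSpace.lipschitzWith_mk_right x) q :=
  LipschitzWith.of_dist_le_mul fun a b => dist_le_of_gap fun f hf => by
    rw [integral_map _ q hf, integral_map _ q hf, ← integral_sub]
    · refine (abs_integral_le_integral_abs).trans ?_
      calc _ ≤ ∫ _, dist a b ∂q.toMeasure := by
            refine integral_mono_of_nonneg (ae_of_all _ fun _ => abs_nonneg _)
              (integrable_const _) (ae_of_all _ fun y => ?_)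
            simpa [TensorSpace.dist_def, Real.dist_eq] using
              hf.dist_le_mul (⟨a, y⟩ : TensorSpace X Y) ⟨b, y⟩
        _ = _ := by simp
    all_goals exact q.integrable _ (by
      refine LipschitzWith.of_dist_le_mul fun y y' => ?_
      refine (hf.dist_le_mul _ _).trans ?_
      simp [TensorSpace.dist_def])

variable [MeasurableSpace X] [BorelSpace X] [CompleteSpace X] [CompleteSpace Y]

/-- The product joint `p ⊗_∇ q`: the Radon probability measure on (all Borel sets of) `X ⊗ Y`
with `∫ f d(p ⊗_∇ q) = ∫ ∫ f(x,y) dq(y) dp(x)`; it is built as the average over `x ~ p` of the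
images of `q` under `y ↦ (x,y)`. See `integral_productJoint`, `productJoint_apply`. -/
noncomputable def productJoint (p : KantorovichSpace X) (q : KantorovichSpace Y) :
    KantorovichSpace (TensorSpace X Y) :=
  expect (map (fun x : X => map (fun y : Y => (⟨x, y⟩ : TensorSpace X Y))
      (TensorSpace.lipschitzWith_mk_right x) q) (lipschitzWith_section q) p)

theorem integral_productJoint (p : KantorovichSpace X) (q : KantorovichSpace Y)
    {f : TensorSpace X Y → ℝ} (hf : LipschitzWith 1 f) :
    ∫ z, f z ∂(productJoint p q).toMeasure =
      ∫ x, ∫ y, f ⟨x, y⟩ ∂q.toMeasure ∂p.toMeasure := by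
  rw [productJoint, integral_expect _ hf, integral_map _ _ (lipschitzWith_integral one_pos hf)]
  exact integral_congr_ae (ae_of_all _ fun x => integral_map _ q hf)

theorem productJoint_apply (p : KantorovichSpace X) (q : KantorovichSpace Y)
    {A : Set (TensorSpace X Y)} (hA : MeasurableSet A) :
    (productJoint p q).toMeasure A =
      ∫⁻ x, q.toMeasure {y | (⟨x, y⟩ : TensorSpace X Y) ∈ A} ∂p.toMeasure := by
  have h := Measure.bind_apply (m := (map (fun x : X => map
      (fun y : Y => (⟨x, y⟩ : TensorSpace X Y))
      (TensorSpace.lipschitzWith_mk_right x) q) (lipschitzWith_section q) p).toMeasure)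
      hA measurable_toMeasure.aemeasurable
  refine h.trans ?_
  refine (lintegral_map ((Measure.measurable_coe hA).comp measurable_toMeasure)
    (lipschitzWith_section q).continuous.measurable).trans ?_
  refine lintegral_congr fun x => ?_
  exact Measure.map_apply (TensorSpace.lipschitzWith_mk_right x).continuous.measurable hA

end KantorovichSpace

/-- The objects of `CMet`: complete metric spaces. -/
structure CMet : Type (u + 1) where
  carrier : Type u
  [metricSpace : MetricSpace carrier]
  [completeSpace : CompleteSpace carrier]

namespace CMet

instance : CoeSort CMet.{u} (Type u) := ⟨carrier⟩

attribute [instance] metricSpace completeSpace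

/-- Every complete metric space carries its Borel sets. -/
instance (X : CMet.{u}) : MeasurableSpace X.carrier := borel X.carrier

instance (X : CMet.{u}) : BorelSpace X.carrier := ⟨rfl⟩

/-- The morphisms of `CMet`: short maps, `d(f x, f x') ≤ d(x, x')`. -/
@[ext]
structure Hom (X Y : CMet.{u}) : Type u where
  toFun : X → Y
  short : LipschitzWith 1 toFun

instance : Category CMet.{u} where
  Hom := Hom
  id X := ⟨id, LipschitzWith.id⟩
  comp f g := ⟨g.toFun ∘ f.toFun, by simpa using g.short.comp f.short⟩

instance (X Y : CMet.{u}) : CoeFun (X ⟶ Y) fun _ => X → Y := ⟨Hom.toFun⟩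

@[ext]
theorem hom_ext {X Y : CMet.{u}} {f g : X ⟶ Y} (h : ∀ x, f x = g x) : f = g :=
  Hom.ext (funext h)

@[simp] theorem id_apply {X : CMet.{u}} (x : X) : (𝟙 X : X ⟶ X) x = x := rfl

@[simp] theorem comp_apply {X Y Z : CMet.{u}} (f : X ⟶ Y) (g : Y ⟶ Z) (x : X) :
    (f ≫ g) x = g (f x) := rfl

/-- A pair of mutually inverse short maps is an isomorphism. -/
def mkIso {X Y : CMet.{u}} (f : X → Y) (g : Y → X) (hf : LipschitzWith 1 f)
    (hg : LipschitzWith 1 g) (hfg : ∀ x, g (f x) = x) (hgf : ∀ y, f (g y) = y) : X ≅ Y where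
  hom := ⟨f, hf⟩
  inv := ⟨g, hg⟩
  hom_inv_id := hom_ext hfg
  inv_hom_id := hom_ext hgf

theorem lip_of_le {X Y : CMet.{u}} {f : X → Y} (h : ∀ a b, dist (f a) (f b) ≤ dist a b) :
    LipschitzWith 1 f := LipschitzWith.of_dist_le_mul fun a b => by simpa using h a b

theorem Hom.dist_le {X Y : CMet.{u}} (f : X ⟶ Y) (a b : X) : dist (f a) (f b) ≤ dist a b := by
  simpa using f.short.dist_le_mul a b

/-- The tensor product of complete metric spaces: the product set with the sum metric. -/
def tensor (X Y : CMet.{u}) : CMet.{u} := ⟨TensorSpace X Y⟩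

/-- The tensor product of short maps. -/
def tensorMap {X X' Y Y' : CMet.{u}} (f : X ⟶ X') (g : Y ⟶ Y') : tensor X Y ⟶ tensor X' Y' :=
  ⟨fun a => ⟨f a.fst, g a.snd⟩, lip_of_le (X := tensor X Y) (Y := tensor X' Y') fun _ _ =>
    add_le_add (Hom.dist_le f _ _) (Hom.dist_le g _ _)⟩

instance : MonoidalCategoryStruct CMet.{u} where
  tensorObj := tensor
  tensorHom f g := tensorMap f g
  whiskerLeft X _ _ f := tensorMap (𝟙 X) f
  whiskerRight f Y := tensorMap f (𝟙 Y)
  tensorUnit := ⟨PUnit.{u + 1}⟩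
  associator X Y Z := mkIso (X := tensor (tensor X Y) Z) (Y := tensor X (tensor Y Z))
    (fun a => ⟨a.fst.fst, ⟨a.fst.snd, a.snd⟩⟩) (fun a => ⟨⟨a.fst, a.snd.fst⟩, a.snd.snd⟩)
    (lip_of_le (X := tensor (tensor X Y) Z) (Y := tensor X (tensor Y Z))
      fun _ _ => (add_assoc _ _ _).ge)
    (lip_of_le (X := tensor X (tensor Y Z)) (Y := tensor (tensor X Y) Z)
      fun _ _ => (add_assoc _ _ _).le)
    (fun _ => rfl) (fun _ => rfl)
  leftUnitor X := mkIso (X := tensor ⟨PUnit.{u + 1}⟩ X) (Y := X)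
    (fun a => a.snd) (fun x => ⟨PUnit.unit, x⟩)
    (lip_of_le fun _ _ => le_add_of_nonneg_left dist_nonneg)
    (lip_of_le (X := X) (Y := tensor ⟨PUnit.{u + 1}⟩ X) fun a b => ((congrArg (· + dist a b) (dist_self PUnit.unit.{u + 1})).trans (zero_add _)).le)
    (fun _ => rfl) (fun _ => rfl)
  rightUnitor X := mkIso (X := tensor X ⟨PUnit.{u + 1}⟩) (Y := X)
    (fun a => a.fst) (fun x => ⟨x, PUnit.unit⟩)
    (lip_of_le fun _ _ => le_add_of_nonneg_right dist_nonneg)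
    (lip_of_le (X := X) (Y := tensor X ⟨PUnit.{u + 1}⟩) fun a b => ((congrArg (dist a b + ·) (dist_self PUnit.unit.{u + 1})).trans (add_zero _)).le)
    (fun _ => rfl) (fun _ => rfl)

instance : MonoidalCategory CMet.{u} where
  tensorHom_def _ _ := rfl
  id_tensorHom_id _ _ := rfl
  tensorHom_comp_tensorHom _ _ _ _ := rfl
  whiskerLeft_id _ _ := rfl
  id_whiskerRight _ _ := rfl
  associator_naturality _ _ _ := rfl
  leftUnitor_naturality _ := rfl
  rightUnitor_naturality _ := rfl
  pentagon _ _ _ _ := rfl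
  triangle _ _ := rfl

instance : SymmetricCategory CMet.{u} where
  braiding X Y := mkIso (X := tensor X Y) (Y := tensor Y X)
    (fun a => ⟨a.snd, a.fst⟩) (fun a => ⟨a.snd, a.fst⟩)
    (lip_of_le (X := tensor X Y) (Y := tensor Y X) fun _ _ => (add_comm _ _).le)
    (lip_of_le (X := tensor Y X) (Y := tensor X Y) fun _ _ => (add_comm _ _).le)
    (fun _ => rfl) (fun _ => rfl)
  braiding_naturality_right _ _ _ _ := rfl
  braiding_naturality_left _ _ := rfl
  hexagon_forward _ _ _ := rfl
  hexagon_reverse _ _ _ := rfl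
  symmetry _ _ := rfl

end CMet

section Monad

open KantorovichSpace

/-- The functor `P` on `CMet`: Kantorovich spaces and push-forwards. -/
noncomputable def kantorovichFunctor : CMet.{u} ⥤ CMet.{u} where
  obj X := ⟨KantorovichSpace X⟩
  map f := ⟨map f f.short, lipschitzWith_map f.short⟩
  map_id _ := CMet.hom_ext fun p => map_id p
  map_comp f g := CMet.hom_ext fun p => (map_map f.short g.short (CMet.Hom.short (f ≫ g)) p).symm

/-- The unit `δ`. -/
noncomputable def kantorovichUnit : 𝟭 CMet.{u} ⟶ kantorovichFunctor where
  app _ := ⟨dirac, lipschitzWith_dirac⟩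
  naturality _ _ f := CMet.hom_ext fun x => (map_dirac f.short x).symm

/-- The multiplication `E`. -/
noncomputable def kantorovichMult :
    kantorovichFunctor.{u} ⋙ kantorovichFunctor ⟶ kantorovichFunctor where
  app _ := ⟨expect, lipschitzWith_expect⟩
  naturality _ _ f := CMet.hom_ext fun m => (map_expect f.short m).symm

/-- The Kantorovich monad `(P, δ, E)` on `CMet`. -/
noncomputable def kantorovichMonad : Monad CMet.{u} where
  toFunctor := kantorovichFunctor
  η := kantorovichUnit
  μ := kantorovichMult
  assoc _ := CMet.hom_ext fun m => expect_map_expect m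
  left_unit _ := CMet.hom_ext fun p => expect_dirac p
  right_unit _ := CMet.hom_ext fun p => expect_map_dirac p

end Monad

/-- A (left, tensorial) strength of a monad on a monoidal category. -/
structure TensorialStrength {C : Type*} [Category C] [MonoidalCategory C] (T : Monad C) where
  hom (X Y : C) : X ⊗ T.obj Y ⟶ T.obj (X ⊗ Y)
  naturality {X X' Y Y' : C} (f : X ⟶ X') (g : Y ⟶ Y') :
    (f ⊗ₘ T.map g) ≫ hom X' Y' = hom X Y ≫ T.map (f ⊗ₘ g)
  leftUnitor (Y : C) : hom (𝟙_ C) Y ≫ T.map (λ_ Y).hom = (λ_ (T.obj Y)).hom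
  associator (X Y Z : C) : hom (X ⊗ Y) Z ≫ T.map (α_ X Y Z).hom =
    (α_ X Y (T.obj Z)).hom ≫ X ◁ hom Y Z ≫ hom X (Y ⊗ Z)
  unit (X Y : C) : X ◁ T.η.app Y ≫ hom X Y = T.η.app (X ⊗ Y)
  mul (X Y : C) : X ◁ T.μ.app Y ≫ hom X Y =
    hom X (T.obj Y) ≫ T.map (hom X Y) ≫ T.μ.app (X ⊗ Y)

namespace TensorialStrength

variable {C : Type*} [Category C] [MonoidalCategory C] [SymmetricCategory C] {T : Monad C}

/-- The costrength `TX ⊗ Y ⟶ T(X ⊗ Y)` obtained from a strength through the symmetry. -/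
def costrength (s : TensorialStrength T) (X Y : C) : T.obj X ⊗ Y ⟶ T.obj (X ⊗ Y) :=
  (β_ (T.obj X) Y).hom ≫ s.hom Y X ≫ T.map (β_ Y X).hom

/-- A strength is commutative if the two induced maps `TX ⊗ TY ⟶ T(X ⊗ Y)` agree. -/
def IsCommutative (s : TensorialStrength T) : Prop :=
  ∀ X Y : C,
    s.hom (T.obj X) Y ≫ T.map (s.costrength X Y) ≫ T.μ.app (X ⊗ Y) =
      s.costrength X (T.obj Y) ≫ T.map (s.hom X Y) ≫ T.μ.app (X ⊗ Y)

end TensorialStrength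

/-! A Radon measure of finite first moment is determined by its integrals of short maps
(`ext_of_integral`), so every equation between measures can be tested on a short function `h`. The
strength has a transparent formula there: integrating `h` against `δ_x ⊗_∇ q` gives `∫ h(x,y) dq(y)`
(`integral_strength`). With the corresponding formulas for push-forward, Dirac measures and `E`,
both sides of each strength axiom evaluate to the same integral. Shortness of the strength comes
from moving one coordinate at a time, which is exactly what the sum metric pays for.

Commutativity is the only axiom with analytic content: it says that `∫∫ h dp dq = ∫∫ h dq dp`. The
obstacle is that `X` and `Y` need not be separable, so a short `h` is Borel on `X ⊗ Y` but need not
be measurable for the product of the two Borel σ-algebras, as Fubini's theorem requires. However, a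
Radon measure `p` is concentrated on the closure of a countable set `c`
(`exists_countable_ae_mem_closure`), and over that closure `h` is a countable infimum of
product-measurable functions (`exists_measurable_eq_on_closure`). Fubini applies to this infimum,
and the result transfers back to `h` (`integral_integral_swap`). -/

theorem TensorSpace.lipschitzWith_swap {X Y : Type u} [MetricSpace X] [MetricSpace Y] :
    LipschitzWith 1 fun a : TensorSpace X Y => (⟨a.snd, a.fst⟩ : TensorSpace Y X) :=
  LipschitzWith.of_dist_le_mul fun a b => by simp [dist_def, add_comm]

namespace KantorovichSpace

/-! ### Fubini's theorem for short maps, without separability -/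

section Fubini

variable {X Y : Type u} [MetricSpace X] [MetricSpace Y]

theorem lip_fst {f : TensorSpace X Y → ℝ} (hf : LipschitzWith 1 f) (y : Y) :
    LipschitzWith 1 fun x => f ⟨x, y⟩ :=
  lip_comp (TensorSpace.lipschitzWith_mk_left y) hf

theorem lip_snd {f : TensorSpace X Y → ℝ} (hf : LipschitzWith 1 f) (x : X) :
    LipschitzWith 1 fun y => f ⟨x, y⟩ :=
  lip_comp (TensorSpace.lipschitzWith_mk_right x) hf

variable [MeasurableSpace Y] [BorelSpace Y]

/-- The map sending `x` to the image of `q` on the slice over `x` is short, and so is integration of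
`f`; this is their composite. It makes partial integrals admissible integrands for every formula
that is stated for short maps. -/
theorem lipschitzWith_integral_snd (q : KantorovichSpace Y) {f : TensorSpace X Y → ℝ}
    (hf : LipschitzWith 1 f) : LipschitzWith 1 fun x => ∫ y, f ⟨x, y⟩ ∂q.toMeasure := by
  have h := lip_comp (lipschitzWith_section (X := X) q) (lipschitzWith_integral one_pos hf)
  simpa only [integral_map _ q hf] using h

variable [MeasurableSpace X] [BorelSpace X]

/-- Inner regularity exhausts `p`, up to arbitrarily small mass, by compact sets; these are
separable, and so is their countable union. This replaces separability of `X`. -/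
theorem exists_countable_ae_mem_closure (p : KantorovichSpace X) :
    ∃ c : Set X, c.Countable ∧ ∀ᵐ x ∂p.toMeasure, x ∈ closure c := by
  obtain ⟨v, -, hv, hv0⟩ : ∃ v : ℕ → ℝ≥0, StrictAnti v ∧ (∀ n, 0 < v n) ∧
      Tendsto v atTop (𝓝 0) := exists_seq_strictAnti_tendsto 0
  choose K hK hp using fun n =>
    exists_compact p (ε := (v n : ℝ≥0∞)) (by exact_mod_cast hv n)
  obtain ⟨c, hc, hcK⟩ := TopologicalSpace.IsSeparable.iUnion fun n => (hK n).isSeparable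
  refine ⟨c, hc, measure_mono_null (t := (⋃ n, K n)ᶜ) (Set.compl_subset_compl.2 hcK) ?_⟩
  have h0 : Tendsto (fun n => (v n : ℝ≥0∞)) atTop (𝓝 0) := ENNReal.tendsto_coe.2 hv0
  refine le_antisymm (ge_of_tendsto' h0 fun n => ?_) (zero_le)
  exact (measure_mono (Set.compl_subset_compl.2 (Set.subset_iUnion K n))).trans (hp n)

/-- A short map on `X ⊗ Y` agrees over the closure of a countable subset of `X` with a function
measurable for the product of the Borel σ-algebras. -/
theorem exists_measurable_eq_on_closure {f : TensorSpace X Y → ℝ} (hf : LipschitzWith 1 f)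
    {c : Set X} (hc : c.Countable) :
    ∃ g : X × Y → ℝ, Measurable g ∧ ∀ x ∈ closure c, ∀ y, g (x, y) = f ⟨x, y⟩ := by
  have : Countable c := hc.to_subtype
  have hle : ∀ x (s : X) y, f ⟨x, y⟩ ≤ f ⟨s, y⟩ + dist x s := fun x s y => by
    have := (lip_fst hf y).dist_le_mul x s
    rw [Real.dist_eq, NNReal.coe_one, one_mul] at this
    linarith [le_abs_self (f ⟨x, y⟩ - f ⟨s, y⟩)]
  -- McShane-type formula: each term is a function of `y` plus a function of `x`, hence
  -- product-measurable, and the infimum is over a countable set. If `c` is empty its closure is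
  -- empty too, so the default value of the infimum is harmless.
  refine ⟨fun z => ⨅ s : c, (f ⟨s, z.2⟩ + dist z.1 (s : X)), Measurable.iInf fun s => ?_,
    fun x hx y => ?_⟩
  · exact ((lip_snd hf s).continuous.measurable.comp measurable_snd).add
      ((continuous_id.dist continuous_const).measurable.comp measurable_fst)
  · have : Nonempty c := (closure_nonempty_iff.1 ⟨x, hx⟩).to_subtype
    refine le_antisymm (le_of_forall_pos_le_add fun ε hε => ?_) (le_ciInf fun s => hle x s y)
    -- The distance from `x` to `s` is paid twice, once in replacing `f ⟨s, y⟩` by `f ⟨x, y⟩` and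
    -- once as the added term of the infimum; hence `ε / 2`.
    obtain ⟨s, hs, hxs⟩ := Metric.mem_closure_iff.1 hx (ε / 2) (half_pos hε)
    refine (ciInf_le ⟨f ⟨x, y⟩, ?_⟩ (⟨s, hs⟩ : c)).trans ?_
    · rintro _ ⟨t, rfl⟩
      exact hle x t y
    · have := hle s x y
      rw [dist_comm] at this
      dsimp only
      linarith

/-- Fubini's theorem is applied to the product-measurable substitute `g`, which has the same slices
as `f` over `p`-almost every `x`. -/
theorem integral_integral_swap (p : KantorovichSpace X) (q : KantorovichSpace Y)
    {f : TensorSpace X Y → ℝ} (hf : LipschitzWith 1 f) :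
    ∫ x, ∫ y, f ⟨x, y⟩ ∂q.toMeasure ∂p.toMeasure =
      ∫ y, ∫ x, f ⟨x, y⟩ ∂p.toMeasure ∂q.toMeasure := by
  obtain ⟨c, hc, hpc⟩ := exists_countable_ae_mem_closure p
  obtain ⟨g, hg, hgf⟩ := exists_measurable_eq_on_closure hf hc
  have hi : Integrable g (p.toMeasure.prod q.toMeasure) := by
    refine (integrable_prod_iff hg.aestronglyMeasurable).2 ⟨?_, ?_⟩
    · filter_upwards [hpc] with x hx
      simpa only [hgf x hx] using q.integrable _ (lip_snd hf x)
    -- The absolute value of `f` is again short, so its partial integral is a short function of `x`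
    -- and therefore `p`-integrable: finite first moments give joint integrability.
    · have h := p.integrable _ (lipschitzWith_integral_snd q
        (lip_comp hf (lipschitzWith_one_norm (E := ℝ))))
      refine h.congr ?_
      filter_upwards [hpc] with x hx
      simp only [hgf x hx]
  calc _ = ∫ x, ∫ y, g (x, y) ∂q.toMeasure ∂p.toMeasure := by
        refine integral_congr_ae ?_
        filter_upwards [hpc] with x hx
        simp only [hgf x hx]
    _ = ∫ y, ∫ x, g (x, y) ∂p.toMeasure ∂q.toMeasure := MeasureTheory.integral_integral_swap hi
    _ = _ := by
        -- The exceptional set of points `x` does not depend on `y`, so the inner integrals agree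
        -- for every `y`.
        refine integral_congr_ae (ae_of_all _ fun y => integral_congr_ae ?_)
        filter_upwards [hpc] with x hx
        exact hgf x hx y

/-- Integration formula for the Kleisli extension of `k`, the shape `E ∘ P(k)` in which both the
multiplication axiom and commutativity are expressed. -/
theorem integral_expect_map [CompleteSpace Y] (m : KantorovichSpace X) {k : X → KantorovichSpace Y}
    (hk : LipschitzWith 1 k) {f : Y → ℝ} (hf : LipschitzWith 1 f) :
    ∫ y, f y ∂(expect (map k hk m)).toMeasure = ∫ x, ∫ y, f y ∂(k x).toMeasure ∂m.toMeasure := by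
  rw [integral_expect _ hf, integral_map hk m (lipschitzWith_integral one_pos hf)]

end Fubini

/-! ### The strength and its axioms, tested on short maps -/

section Strength

variable {X X' Y Y' Z : Type u} [MetricSpace X] [MeasurableSpace X] [BorelSpace X] [CompleteSpace X]
  [MetricSpace X'] [MeasurableSpace X'] [BorelSpace X'] [CompleteSpace X']
  [MetricSpace Y'] [MeasurableSpace Y'] [BorelSpace Y'] [CompleteSpace Y']
  [MetricSpace Y] [MeasurableSpace Y] [BorelSpace Y] [CompleteSpace Y]
  [MetricSpace Z] [MeasurableSpace Z] [BorelSpace Z]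

/-- The strength `(x, q) ↦ δ_x ⊗_∇ q`. -/
noncomputable def strength (a : TensorSpace X (KantorovichSpace Y)) :
    KantorovichSpace (TensorSpace X Y) :=
  productJoint (dirac a.fst) a.snd

/-- The Dirac measure evaluates the outer integral of the product joint, whose integrand is short.
All the axioms below rest on this formula. -/
theorem integral_strength (a : TensorSpace X (KantorovichSpace Y)) {f : TensorSpace X Y → ℝ}
    (hf : LipschitzWith 1 f) :
    ∫ z, f z ∂(strength a).toMeasure = ∫ y, f ⟨a.fst, y⟩ ∂a.snd.toMeasure := by
  rw [strength, integral_productJoint _ _ hf, integral_dirac _ (lipschitzWith_integral_snd _ hf)]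

theorem lipschitzWith_strength :
    LipschitzWith 1 (strength : TensorSpace X (KantorovichSpace Y) → _) :=
  LipschitzWith.of_dist_le_mul fun a b => dist_le_of_gap fun f hf => by
    rw [integral_strength a hf, integral_strength b hf, NNReal.coe_one, one_mul,
      TensorSpace.dist_def]
    -- Move the point with the measure fixed, then the measure with the point fixed; the two costs
    -- are the two summands of the tensor metric.
    refine (abs_sub_le _ (∫ y, f ⟨b.fst, y⟩ ∂a.snd.toMeasure) _).trans (add_le_add ?_ ?_)
    · simpa [Real.dist_eq] using (lipschitzWith_integral_snd a.snd hf).dist_le_mul a.fst b.fst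
    · exact gap_le_dist _ _ (lip_snd hf b.fst)

theorem integral_map_strength (a : TensorSpace X (KantorovichSpace Y))
    {g : TensorSpace X Y → Z} (hg : LipschitzWith 1 g) {f : Z → ℝ} (hf : LipschitzWith 1 f) :
    ∫ z, f z ∂(map g hg (strength a)).toMeasure =
      ∫ y, f (g ⟨a.fst, y⟩) ∂a.snd.toMeasure := by
  rw [integral_map hg _ hf, integral_strength a (lip_comp hg hf)]

/-- Both sides integrate `h` to `∫ h(f x, g y) dq(y)`. Here and below the structural maps are
written in coordinates, with shortness as a hypothesis, to match the morphisms of `CMet`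
definitionally. -/
theorem strength_map {f : X → X'} {g : Y → Y'} (hg : LipschitzWith 1 g)
    (hfg : LipschitzWith 1 fun a : TensorSpace X Y => (⟨f a.fst, g a.snd⟩ : TensorSpace X' Y'))
    (x : X) (q : KantorovichSpace Y) :
    strength ⟨f x, map g hg q⟩ = map _ hfg (strength ⟨x, q⟩) :=
  ext_of_integral fun h hh => by
    rw [integral_strength _ hh, integral_map_strength _ hfg hh, integral_map hg q (lip_snd hh _)]

theorem map_snd_strength (h : LipschitzWith 1 fun a : TensorSpace X Y => a.snd)
    (x : X) (q : KantorovichSpace Y) : map _ h (strength ⟨x, q⟩) = q :=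
  ext_of_integral fun _ hh => integral_map_strength _ h hh

theorem map_assoc_strength [CompleteSpace Z]
    (h : LipschitzWith 1 fun a : TensorSpace (TensorSpace X Y) Z =>
      (⟨a.fst.fst, ⟨a.fst.snd, a.snd⟩⟩ : TensorSpace X (TensorSpace Y Z)))
    (x : X) (y : Y) (r : KantorovichSpace Z) :
    map _ h (strength ⟨⟨x, y⟩, r⟩) = strength ⟨x, strength ⟨y, r⟩⟩ :=
  ext_of_integral fun k hk => by
    rw [integral_map_strength _ h hk, integral_strength _ hk, integral_strength _ (lip_snd hk _)]

theorem strength_dirac (x : X) (y : Y) : strength ⟨x, dirac y⟩ = dirac ⟨x, y⟩ :=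
  ext_of_integral fun h hh => by
    rw [integral_strength _ hh, integral_dirac _ hh, integral_dirac _ (lip_snd hh _)]

/-- Both sides integrate `h` to `∫∫ h(x,y) dp(y) dm(p)`, in the same order, so no Fubini argument is
needed. -/
theorem strength_expect (x : X) (m : KantorovichSpace (KantorovichSpace Y)) :
    strength ⟨x, expect m⟩ = expect (map strength lipschitzWith_strength (strength ⟨x, m⟩)) :=
  ext_of_integral fun h hh => by
    rw [integral_strength _ hh, integral_expect _ (lip_snd hh _), integral_expect_map _ _ hh,
      integral_strength _ (lip_comp lipschitzWith_strength (lipschitzWith_integral one_pos hh))]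
    exact integral_congr_ae (ae_of_all _ fun p => (integral_strength ⟨x, p⟩ hh).symm)

/-- Both composites `PX ⊗ PY → P(X ⊗ Y)` agree: Fubini's theorem for short maps. -/
theorem expect_map_strength_comm {t : TensorSpace (KantorovichSpace X) Y → _}
    (ht : LipschitzWith 1 t)
    (ht' : ∀ a, t a = map _ TensorSpace.lipschitzWith_swap (strength ⟨a.snd, a.fst⟩))
    (p : KantorovichSpace X) (q : KantorovichSpace Y) :
    expect (map t ht (strength ⟨p, q⟩)) =
      expect (map strength lipschitzWith_strength
        (map _ TensorSpace.lipschitzWith_swap (strength ⟨q, p⟩))) :=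
  ext_of_integral fun h hh => by
    -- The integrand obtained by testing `strength` on `h` must itself be short before the formulas
    -- for push-forward and strength apply to it.
    have hs := lip_comp (lipschitzWith_strength (X := X) (Y := Y))
      (lipschitzWith_integral one_pos hh)
    rw [integral_expect_map _ _ hh, integral_expect_map _ _ hh,
      integral_strength _ (lip_comp ht (lipschitzWith_integral one_pos hh)),
      integral_map_strength _ TensorSpace.lipschitzWith_swap hs]
    simp only [ht', integral_map_strength _ TensorSpace.lipschitzWith_swap hh,
      integral_strength _ hh]
    -- The left side has become the integral over `x` inside that over `y`, the right side the
    -- reverse.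
    exact (integral_integral_swap p q hh).symm

end Strength

end KantorovichSpace

/-! ### Assembly in `CMet` -/

section

open KantorovichSpace

/-- The strength of the Kantorovich monad. -/
noncomputable def kantorovichStrength : TensorialStrength kantorovichMonad.{u} where
  hom X Y := ⟨fun a : TensorSpace X (KantorovichSpace Y) => strength a,
    lipschitzWith_strength (X := X) (Y := Y)⟩
  naturality f g := CMet.hom_ext fun a => strength_map g.short (f ⊗ₘ g).short a.fst a.snd
  leftUnitor Y := CMet.hom_ext fun a => map_snd_strength (λ_ Y).hom.short a.fst a.snd
  associator X Y Z := CMet.hom_ext fun a =>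
    map_assoc_strength (α_ X Y Z).hom.short a.fst.fst a.fst.snd a.snd
  unit _ _ := CMet.hom_ext fun a => strength_dirac a.fst a.snd
  mul _ _ := CMet.hom_ext fun a => strength_expect a.fst a.snd

theorem isCommutative_kantorovichStrength : kantorovichStrength.{u}.IsCommutative := fun X Y =>
  CMet.hom_ext fun a => expect_map_strength_comm (kantorovichStrength.costrength X Y).short
    -- The categorical costrength unfolds definitionally to the swapped strength in coordinates.
    (fun _ => rfl) a.fst a.snd

end

theorem mainTheorem7 :
    ∃ s : TensorialStrength kantorovichMonad.{u}, s.IsCommutative ∧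
      ∀ (X Y : CMet.{u}) (x : X) (q : KantorovichSpace Y),
        s.hom X Y (⟨x, q⟩ : TensorSpace X (KantorovichSpace Y)) =
          KantorovichSpace.productJoint (KantorovichSpace.dirac x) q :=
  ⟨kantorovichStrength, isCommutative_kantorovichStrength, fun _ _ _ _ => rfl⟩
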